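/- Let $n,r\in\mathbb{N}$ with $2<r<n$. Let $A$ be a set of $r$-element subsets of $\{1,\ldots,n\}$ and let $B$ be a set of partitions of $\{1,\ldots,n\}$, each with exactly $r$ classes. Let $T_n$ be the semigroup of all maps $\{1,\ldots,n\}\to\{1,\ldots,n\}$ under composition, and let \[ S(A,B)=\langle\,\{\alpha\in T_n : \operatorname{im}\alpha\in A,\ \ker\alpha\in B\}\,\rangle\le T_n \] be the subsemigroup generated by all maps with image in $A$ and kernel in $B$, where $\ker\alpha$ is the partition of $\{1,\ldots,n\}$ into the non-empty fibres of $\alpha$. Let $\Gamma(A,B)$ be the bipartite graph with vertex set $A\cup B$ (disjoint union) in which $a\in A$ and $b\in B$ are adjacent if and only if $a$ is a transversal of $b$, that is, $a$ contains exactly one point of each class of $b$. For a set $X$ of vertices let $v_0(X)$ and $v_+(X)$ be the numbers of vertices in $X$ whose degree in $\Gamma(A,B)$ is zero and positive, respectively, and let $\Delta$ be the maximum degree of a vertex of $\Gamma(A,B)$ (with $\Delta=0$ if there are no vertices). The rank of a finite semigroup $S$ is $\operatorname{rank}(S)=\min\{|X| : X\subseteq S,\ \langle X\rangle=S\}$,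 where $\langle X\rangle$ is the subsemigroup generated by $X$ (the empty semigroup has rank $0$). Then \[ \operatorname{rank}(S(A,B))=\begin{cases} \max(v_+(A),v_+(B))+v_0(A\cup B) & \text{if } \Delta\ge 2,\\ \max(v_+(A),v_+(B))+v_0(A\cup B)+1 & \text{if } \Delta=1,\\ |A|\,|B|\,r! & \text{if } \Delta=0. \end{cases} \] -/

import Mathlib

/-- The rank of a finite semigroup `S`: the least cardinality of a subset generating `S`
as a semigroup. -/
noncomputable def semigroupRank (S : Type*) [Mul S] [Finite S] : ℕ :=
  sInf {k : ℕ | ∃ X : Finset S, X.card = k ∧ Subsemigroup.closure (X : Set S) = ⊤}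

/-- The minimum defining the rank of a finite semigroup is attained. -/
theorem semigroupRank_isLeast (S : Type*) [Mul S] [Finite S] :
    IsLeast {k : ℕ | ∃ X : Finset S, X.card = k ∧ Subsemigroup.closure (X : Set S) = ⊤}
      (semigroupRank S) := by
  refine ⟨Nat.sInf_mem ?_, fun k hk => Nat.sInf_le hk⟩
  have := Fintype.ofFinite S
  exact ⟨_, Finset.univ, rfl, by simp⟩

/-- The semigroup `S(A,B)`: the subsemigroup of the full transformation monoid on `Fin n`
generated by all maps with image in `A` and kernel in `B`. Partitions of `Fin n` are given as
equivalence relations. -/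
def prescribedSemigroup {n : ℕ} (A : Finset (Finset (Fin n))) (B : Finset (Setoid (Fin n))) :
    Subsemigroup (Function.End (Fin n)) :=
  Subsemigroup.closure
    {α : Function.End (Fin n) | (∃ a ∈ A, Set.range α = (a : Set (Fin n))) ∧ Setoid.ker α ∈ B}

instance {n : ℕ} (A : Finset (Finset (Fin n))) (B : Finset (Setoid (Fin n))) :
    Finite (prescribedSemigroup A B) :=
  have : Finite (Function.End (Fin n)) := inferInstanceAs (Finite (Fin n → Fin n))
  Subtype.finite

/-- `a` is a transversal of the partition into the classes of `b`: it meets every class in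
exactly one point. -/
def IsTransversal {n : ℕ} (a : Finset (Fin n)) (b : Setoid (Fin n)) : Prop :=
  ∀ c ∈ b.classes, ∃! x, x ∈ a ∧ x ∈ c

/-- The bipartite graph `Γ(A,B)` on the disjoint union of `A` and `B`, with `a` joined to `b`
if and only if `a` is a transversal of `b`. -/
def transversalGraph {n : ℕ} (A : Finset (Finset (Fin n))) (B : Finset (Setoid (Fin n))) :
    SimpleGraph (A ⊕ B) where
  Adj
    | .inl a, .inr b => IsTransversal a.1 b.1
    | .inr b, .inl a => IsTransversal a.1 b.1
    | .inl _, .inl _ => False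
    | .inr _, .inr _ => False
  symm := ⟨by rintro (a | b) (a' | b') h <;> exact h⟩
  loopless := ⟨by rintro (a | b) h <;> exact h⟩

open Classical in
/-- The number `v₀(X)` of vertices in `X` of degree zero. -/
noncomputable def vZero {V : Type*} [Fintype V] (Γ : SimpleGraph V) (X : Finset V) : ℕ :=
  (X.filter fun x => Γ.degree x = 0).card

open Classical in
/-- The number `v₊(X)` of vertices in `X` of positive degree. -/
noncomputable def vPos {V : Type*} [Fintype V] (Γ : SimpleGraph V) (X : Finset V) : ℕ :=
  (X.filter fun x => 0 < Γ.degree x).card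

open Classical in
/-- The maximum degree of a vertex of a finite graph (zero if there are no vertices). -/
noncomputable def maxDeg {V : Type*} [Fintype V] (Γ : SimpleGraph V) : ℕ :=
  Γ.maxDegree

/-- The vertices of `Γ(A,B)` that lie in `A`. -/
def imageVertices {n : ℕ} (A : Finset (Finset (Fin n))) (B : Finset (Setoid (Fin n))) :
    Finset (A ⊕ B) :=
  Finset.univ.map Function.Embedding.inl

/-- The vertices of `Γ(A,B)` that lie in `B`. -/
def kernelVertices {n : ℕ} (A : Finset (Finset (Fin n))) (B : Finset (Setoid (Fin n))) :
    Finset (A ⊕ B) :=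
  Finset.univ.map Function.Embedding.inr

/-!
After a choice of coordinates `S(A,B)` consists of a Rees matrix family `mk (a, g, b)`, with
`g` a permutation of `r` points, together with products of smaller rank. The elements of the
family in the semigroup generated by `X` are then the labelled walks from `A` to `B` in the
digraph on `A ⊔ B` whose arcs are the elements of `X` (from `A` to `B`) and the edges of `Γ(A,B)`
(from `B` to `A`).

For the lower bounds, every vertex of `A` needs a generator leaving it and every vertex of `B` a
generator entering it, and generators at isolated vertices cannot serve twice. If `Γ(A,B)` is a
matching and no further generator is present, the closed walks at a vertex are initial pieces of a
single infinite walk, so that their labels commute; this is impossible for `r > 2`.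

For the upper bounds, isolated vertices are added at the cost of one generator each. Among all
ways of choosing `max(v₊(A), v₊(B))` arcs from `A` to `B` with prescribed ends up to a permutation,
one with the most reachable pairs makes the digraph strongly connected. Arcs that join the connected
components of `Γ(A,B)` to each other are labelled by `1`, and the labels of the remaining ones can
be chosen so that some closed walks carry generators of the symmetric group.
-/

open Relation Relator

section StronglyConnected

variable {ι : Type*} {r r' : ι → ι → Prop}

/-- A path towards `z` whose vertices are reachable from `z` stays in the strong component
of `z`. -/
theorem reflTransGen_of_agree_on_component {i z : ι}
    (h : ∀ k l, k ≠ z → TransGen r z k → TransGen r k z → r k l → r' k l)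
    (hzi : TransGen r z i) (hiz : ReflTransGen r i z) : ReflTransGen r' i z := by
  induction hiz using ReflTransGen.head_induction_on with
  | refl => exact .refl
  | @head k l hkl hlz ih =>
    by_cases hkz : k = z
    · exact hkz ▸ .refl
    · exact .head (h k l hkz hzi (.head' hkl hlz) hkl) (ih (hzi.tail hkl))

theorem transGen_swap_of_not_transGen [DecidableEq ι] {x y : ι} (hx : TransGen r x x)
    (hy : TransGen r y y) (hyx : ¬ TransGen r y x) :
    TransGen (fun i j => r (Equiv.swap x y i) j) y x ∧
      ∀ i j, TransGen r i j → TransGen (fun i j => r (Equiv.swap x y i) j) i j := by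
  set r' : ι → ι → Prop := fun i j => r (Equiv.swap x y i) j with hr'
  have off : ∀ k l, k ≠ x → k ≠ y → r k l → r' k l := fun k l hkx hky h => by
    simpa only [hr', Equiv.swap_apply_of_ne_of_ne hkx hky] using h
  have from_x : ∀ l, r x l → r' y l := fun l h => by simpa only [hr', Equiv.swap_apply_right]
  have from_y : ∀ l, r y l → r' x l := fun l h => by simpa only [hr', Equiv.swap_apply_left]
  have yx : TransGen r' y x := by
    obtain ⟨l, hxl, hlx⟩ := TransGen.head'_iff.1 hx
    refine .head' (from_x l hxl) (reflTransGen_of_agree_on_component ?_ (.single hxl) hlx)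
    exact fun k m hkx _ hk => off k m hkx (by rintro rfl; exact hyx hk)
  have xy : TransGen r' x y := by
    obtain ⟨l, hyl, hly⟩ := TransGen.head'_iff.1 hy
    refine .head' (from_y l hyl) (reflTransGen_of_agree_on_component ?_ (.single hyl) hly)
    exact fun k m hky hk _ => off k m (by rintro rfl; exact hyx hk) hky
  have arc : ∀ i j, r i j → TransGen r' i j := fun i j h => by
    by_cases hix : i = x
    · exact hix ▸ xy.tail (from_x j (hix ▸ h))
    by_cases hiy : i = y
    · exact hiy ▸ yx.tail (from_y j (hiy ▸ h))
    exact .single (off i j hix hiy h)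
  refine ⟨yx, fun i j h => ?_⟩
  induction h with
  | single h => exact arc _ _ h
  | tail _ h ih => exact ih.trans (arc _ _ h)

theorem exists_transGen_cyclic [Finite ι] (h : LeftTotal r) (i : ι) :
    ∃ c, TransGen r i c ∧ TransGen r c c := by
  obtain ⟨j, hij⟩ := h i
  have : Nonempty {c // TransGen r i c} := ⟨⟨j, .single hij⟩⟩
  -- A vertex with the fewest descendants has the same descendants as each of its successors.
  obtain ⟨⟨c, hic⟩, hmin⟩ :=
    Finite.exists_min fun c : {c // TransGen r i c} => {k | TransGen r c k}.ncard
  obtain ⟨d, hcd⟩ := h c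
  have hsub : {k | TransGen r d k} ⊆ {k | TransGen r c k} := fun k hk => .head hcd hk
  have heq := Set.eq_of_subset_of_ncard_le hsub (hmin ⟨d, hic.tail hcd⟩) (Set.toFinite _)
  exact ⟨d, hic.tail hcd, heq.ge (TransGen.single hcd)⟩

theorem transGen_of_forall_cyclic [Finite ι] (h : BiTotal r)
    (hcyc : ∀ x y, TransGen r x x → TransGen r y y → TransGen r y x) (i j : ι) :
    TransGen r i j := by
  obtain ⟨c, hic, hc⟩ := exists_transGen_cyclic h.1 i
  obtain ⟨d, hjd, hd⟩ := exists_transGen_cyclic (r := Function.swap r) h.2 j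
  rw [transGen_swap] at hjd hd
  exact (hic.trans (hcyc d c hd hc)).trans hjd

theorem exists_perm_transGen [Finite ι] {R : ι → ι → Prop} (hR : BiTotal R) :
    ∃ σ : Equiv.Perm ι, ∀ i j, TransGen (fun i j => R (σ i) j) i j := by
  classical
  obtain ⟨σ, hσ⟩ := Finite.exists_max fun σ : Equiv.Perm ι =>
    {q : ι × ι | TransGen (fun i j => R (σ i) j) q.1 q.2}.ncard
  have hRσ : BiTotal fun i j => R (σ i) j :=
    ⟨fun i => hR.1 (σ i), fun j => (hR.2 j).imp' σ.symm fun i h => by simpa using h⟩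
  refine ⟨σ, transGen_of_forall_cyclic hRσ fun x y hx hy => by_contra fun hyx => ?_⟩
  obtain ⟨hnew, hold⟩ := transGen_swap_of_not_transGen hx hy hyx
  refine (hσ (σ * Equiv.swap x y)).not_gt (Set.ncard_lt_ncard ?_ (Set.toFinite _))
  exact ⟨fun q => hold q.1 q.2, fun hsub => hyx (hsub (a := (y, x)) hnew)⟩

end StronglyConnected

section Components

theorem card_lt_of_surjective_not_injective {α β : Type*} [Finite α] {f : α → β}
    (hf : Function.Surjective f) (hf' : ¬ Function.Injective f) : Nat.card β < Nat.card α :=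
  lt_of_le_of_ne (Nat.card_le_card_of_surjective f hf) fun h =>
    hf' ((Nat.bijective_iff_surjective_and_card f).2 ⟨hf, h.symm⟩).1

theorem exists_finset_sup_eq_top {L ι : Type*} [CompleteLattice L] {f : L → ℕ} (hf : StrictAnti f)
    (c : ι → L) (a : L) (h : a ⊔ ⨆ i, c i = ⊤) :
    ∃ T : Finset ι, T.card + f ⊤ ≤ f a ∧ a ⊔ T.sup c = ⊤ := by
  classical
  induction hn : f a using Nat.strong_induction_on generalizing a with
  | _ n ih =>
    by_cases hle : ∀ i, c i ≤ a
    · obtain rfl : a = ⊤ := by rwa [sup_eq_left.2 (iSup_le hle)] at h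
      exact ⟨∅, by simp [hn], by simp⟩
    obtain ⟨i, hi⟩ := not_forall.1 hle
    have hlt : f (a ⊔ c i) < f a := hf (left_lt_sup.2 hi)
    obtain ⟨T, hcard, hT⟩ := ih _ (hn ▸ hlt) (a ⊔ c i)
      (by rw [sup_assoc, sup_eq_right.2 (le_iSup c i), h]) rfl
    refine ⟨insert i T, ?_, by rw [Finset.sup_insert, ← sup_assoc, hT]⟩
    have := Finset.card_insert_le i T
    omega

theorem strictAnti_card_quotient (V : Type*) [Finite V] :
    StrictAnti fun r : Setoid V => Nat.card (Quotient r) := by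
  intro r s hrs
  let f : Quotient r → Quotient s := Quotient.map' id fun x y h => hrs.le h
  have hsurj : Function.Surjective f := fun q => q.inductionOn fun x => ⟨⟦x⟧, rfl⟩
  have hninj : ¬ Function.Injective f := fun hinj =>
    hrs.not_ge fun x y hxy => Quotient.exact (@hinj ⟦x⟧ ⟦y⟧ (Quotient.sound hxy))
  exact card_lt_of_surjective_not_injective hsurj hninj

theorem exists_finset_connecting {V ι : Type*} [Finite V] [Nonempty V] {R : V → V → Prop}
    {s t : ι → V} (h : ∀ x y, ReflTransGen (fun x y => R x y ∨ ∃ k, x = s k ∧ y = t k) x y) :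
    ∃ T : Finset ι, T.card + 1 ≤ Nat.card (Quotient (EqvGen.setoid R)) ∧
      EqvGen.setoid R ⊔ T.sup (fun k => EqvGen.setoid fun x y => x = s k ∧ y = t k) = ⊤ := by
  set c : ι → Setoid V := fun k => EqvGen.setoid fun x y => x = s k ∧ y = t k
  have hconn : EqvGen.setoid R ⊔ ⨆ k, c k = ⊤ := by
    set u := EqvGen.setoid R ⊔ ⨆ k, c k
    have hu : ∀ x y, (R x y ∨ ∃ k, x = s k ∧ y = t k) → u x y := by
      rintro x y (hxy | ⟨k, hxy⟩)
      · exact (le_sup_left : _ ≤ u) (EqvGen.rel _ _ hxy)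
      · exact ((le_iSup c k).trans (le_sup_right : _ ≤ u)) (EqvGen.rel _ _ hxy)
    exact Setoid.eq_top_iff.2 fun x y =>
      reflTransGen_le_of_equivalence_of_le u.iseqv hu _ _ (h x y)
  obtain ⟨T, hcard, hT⟩ :=
    exists_finset_sup_eq_top (strictAnti_card_quotient V) c (EqvGen.setoid R) hconn
  have : Nonempty (Quotient (⊤ : Setoid V)) := Nonempty.map (Quotient.mk _) ‹_›
  exact ⟨T, (Nat.add_le_add_left Nat.card_pos _).trans hcard, hT⟩

end Components

/-- `LabelledWalk E x y g`: there is a walk from `x` to `y` in the digraph with labelled arcs `E`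
whose labels multiply to `g`. -/
inductive LabelledWalk {V G : Type*} [Monoid G] (E : V → V → G → Prop) : V → V → G → Prop
  | nil (x : V) : LabelledWalk E x x 1
  | cons {x y z : V} {g h : G} : E x y g → LabelledWalk E y z h → LabelledWalk E x z (g * h)

namespace LabelledWalk

section Monoid

variable {V G : Type*} [Monoid G] {E F : V → V → G → Prop} {x y z : V} {g h : G}

theorem of_arc (hE : E x y g) : LabelledWalk E x y g := by
  simpa only [mul_one] using cons hE (nil y)

theorem trans (hg : LabelledWalk E x y g) (hh : LabelledWalk E y z h) :
    LabelledWalk E x z (g * h) := by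
  induction hg with
  | nil => rwa [one_mul]
  | cons hE _ ih => exact mul_assoc (G := G) _ _ _ ▸ cons hE (ih hh)

theorem pow (hg : LabelledWalk E x x g) (k : ℕ) : LabelledWalk E x x (g ^ k) := by
  induction k with
  | zero => exact pow_zero g ▸ nil x
  | succ k ih => exact pow_succ g k ▸ ih.trans hg

theorem bind (hg : LabelledWalk E x y g) (hEF : ∀ x y g, E x y g → LabelledWalk F x y g) :
    LabelledWalk F x y g := by
  induction hg with
  | nil => exact nil _
  | cons hE _ ih => exact (hEF _ _ _ hE).trans ih

theorem mono (hg : LabelledWalk E x y g) (hEF : ∀ x y g, E x y g → F x y g) :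
    LabelledWalk F x y g :=
  hg.bind fun _ _ _ hE => of_arc (hEF _ _ _ hE)

theorem exists_of_reflTransGen (hxy : ReflTransGen (fun x y => ∃ g, E x y g) x y) :
    ∃ g, LabelledWalk E x y g := by
  induction hxy with
  | refl => exact ⟨1, nil x⟩
  | tail _ hE ih => exact ⟨_, ih.choose_spec.trans (of_arc hE.choose_spec)⟩

theorem eq_or_exists_last_arc (hg : LabelledWalk E x z g) :
    x = z ∨ ∃ y h k, LabelledWalk E x y h ∧ E y z k := by
  induction hg with
  | nil => exact .inl rfl
  | cons hE _ ih =>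
    rcases ih with rfl | ⟨y, h, k, hw, hE'⟩
    · exact .inr ⟨_, _, _, nil _, hE⟩
    · exact .inr ⟨_, _, _, cons hE hw, hE'⟩

theorem exists_iterate_eq {f : V → V} {c : V → G}
    (hE : ∀ x y g, E x y g → (∃ z h, E y z h) → f x = y ∧ c x = g)
    (hg : LabelledWalk E x y g) (hy : ∃ z h, E y z h) :
    ∃ n, ∀ u, (fun q : V × G => (f q.1, q.2 * c q.1))^[n] (x, u) = (y, u * g) := by
  induction hg with
  | nil => exact ⟨0, fun u => by simp only [Function.iterate_zero, id_eq, mul_one]⟩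
  | cons hxw hwy ih =>
    obtain ⟨n, hn⟩ := ih hy
    obtain ⟨rfl, rfl⟩ := hE _ _ _ hxw <| by
      cases hwy with
      | nil => exact hy
      | cons hw _ => exact ⟨_, _, hw⟩
    exact ⟨n + 1, fun u => by rw [Function.iterate_succ_apply, hn, mul_assoc]⟩

theorem commute_of_deterministic {f : V → V} {c : V → G}
    (hE : ∀ x y g, E x y g → (∃ z h, E y z h) → f x = y ∧ c x = g)
    (hg : LabelledWalk E x x g) (hh : LabelledWalk E x x h) (hx : ∃ z h, E x z h) :
    Commute g h := by
  obtain ⟨n, hn⟩ := hg.exists_iterate_eq hE hx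
  obtain ⟨m, hm⟩ := hh.exists_iterate_eq hE hx
  have h1 := Function.iterate_add_apply (fun q : V × G => (f q.1, q.2 * c q.1)) n m (x, 1)
  have h2 := Function.iterate_add_apply (fun q : V × G => (f q.1, q.2 * c q.1)) m n (x, 1)
  rw [hm, hn, one_mul] at h1
  rw [hn, hm, one_mul, add_comm, h1] at h2
  exact (congrArg Prod.snd h2).symm

end Monoid

section Group

variable {V G : Type*} [Group G] {E : V → V → G → Prop} {x y : V} {g : G}

theorem symm_of_arcs (hg : LabelledWalk E x y g)
    (hE : ∀ x y g, E x y g → LabelledWalk E y x g⁻¹) : LabelledWalk E y x g⁻¹ := by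
  induction hg with
  | nil => simpa only [inv_one] using nil _
  | cons h _ ih => exact mul_inv_rev (G := G) _ _ ▸ ih.trans (hE _ _ _ h)

theorem symm [Finite G] (hg : LabelledWalk E x y g) (hE : ∀ x y, ∃ g, LabelledWalk E x y g) :
    LabelledWalk E y x g⁻¹ := by
  obtain ⟨h, hh⟩ := hE y x
  have hpow : h * (g * h) ^ (orderOf (g * h) - 1) = g⁻¹ := by
    rw [eq_inv_iff_mul_eq_one.2 (pow_sub_one_mul (orderOf_pos (g * h)).ne' (g * h)
      |>.trans (pow_orderOf_eq_one _)), mul_inv_rev, mul_inv_cancel_left]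
  exact hpow ▸ hh.trans ((hg.trans hh).pow _)

theorem exists_of_eqvGen (hxy : EqvGen (fun x y => ∃ g, E x y g) x y) :
    ∃ g, LabelledWalk (fun x y g => E x y g ∨ E y x g⁻¹) x y g := by
  induction hxy with
  | rel _ _ h => exact ⟨h.choose, of_arc (.inl h.choose_spec)⟩
  | refl x => exact ⟨1, nil x⟩
  | symm _ _ _ ih =>
    exact ⟨_, ih.choose_spec.symm_of_arcs fun _ _ g h => of_arc (by simpa [or_comm] using h)⟩
  | trans _ _ _ _ _ ih ih' => exact ⟨_, ih.choose_spec.trans ih'.choose_spec⟩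

theorem of_loop_generators [Finite G] (hE : ∀ x y, ∃ g, LabelledWalk E x y g) {x₀ : V} {φ : V → G}
    (hφ : ∀ x, LabelledWalk E x₀ x (φ x)) {U : Set G} (hU : Subgroup.closure U = ⊤)
    (harc : ∀ u ∈ U, ∃ x y, E x y ((φ x)⁻¹ * u * φ y)) (x y : V) (g : G) :
    LabelledWalk E x y g := by
  let K : Subgroup G :=
    { carrier := {h | LabelledWalk E x₀ x₀ h}
      one_mem' := nil x₀
      mul_mem' := trans
      inv_mem' := fun h => h.symm hE }
  have hUK : U ⊆ K := fun u hu => by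
    obtain ⟨x, y, hxy⟩ := harc u hu
    have hu : LabelledWalk E x₀ x₀ _ := ((hφ x).trans (of_arc hxy)).trans ((hφ y).symm hE)
    rwa [← mul_assoc, ← mul_assoc, mul_inv_cancel, one_mul, mul_inv_cancel_right] at hu
  have hK : φ x * g * (φ y)⁻¹ ∈ K := (hU.ge.trans ((Subgroup.closure_le K).2 hUK)) trivial
  have hg := (((hφ x).symm hE).trans hK).trans (hφ y)
  rwa [mul_assoc, inv_mul_cancel_right, inv_mul_cancel_left] at hg

/-- Arcs of a connecting set `T` are labelled `1`; each further arc then closes a cycle whose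
label can be prescribed freely. -/
theorem exists_labels [Finite G] {ι : Type*} {s t : ι → V} {T : Finset ι} {w : ι → G}
    (hT : EqvGen.setoid (fun x y => ∃ g, E x y g) ⊔
      T.sup (fun k => EqvGen.setoid fun x y => x = s k ∧ y = t k) = ⊤)
    (hs : ∀ x y, ReflTransGen (fun x y => (∃ g, E x y g) ∨ ∃ k, x = s k ∧ y = t k) x y)
    (hw : Subgroup.closure (w '' (T : Set ι)ᶜ) = ⊤) :
    ∃ γ : ι → G, ∀ x y g,
      LabelledWalk (fun x y g => E x y g ∨ ∃ k, x = s k ∧ y = t k ∧ g = γ k) x y g := by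
  classical
  rcases isEmpty_or_nonempty V with hV | ⟨⟨x₀⟩⟩
  · exact ⟨1, fun x => isEmptyElim x⟩
  let F : V → V → G → Prop := fun x y g => E x y g ∨ ∃ k ∈ T, x = s k ∧ y = t k ∧ g = 1
  have hF : EqvGen.setoid (fun x y => ∃ g, F x y g) = ⊤ := by
    refine top_le_iff.1 (hT.ge.trans (sup_le (Setoid.eqvGen_mono ?_) (Finset.sup_le ?_)))
    · exact fun x y ⟨g, hg⟩ => ⟨g, .inl hg⟩
    · exact fun k hk => Setoid.eqvGen_mono fun x y ⟨hx, hy⟩ => ⟨1, .inr ⟨k, hk, hx, hy, rfl⟩⟩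
  choose φ hφ using fun x => exists_of_eqvGen (Setoid.eq_top_iff.1 hF x₀ x)
  let γ : ι → G := fun k => if k ∈ T then 1 else (φ (s k))⁻¹ * w k * φ (t k)
  refine ⟨γ, ?_⟩
  set D : V → V → G → Prop := fun x y g => E x y g ∨ ∃ k, x = s k ∧ y = t k ∧ g = γ k
  have hD : ∀ x y, ∃ g, LabelledWalk D x y g := fun x y => exists_of_reflTransGen <|
    ReflTransGen.mono (fun x y h => by
      rcases h with ⟨g, hg⟩ | ⟨k, hx, hy⟩
      exacts [⟨g, .inl hg⟩, ⟨γ k, .inr ⟨k, hx, hy, rfl⟩⟩]) _ _ (hs x y)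
  have hFD : ∀ x y g, F x y g → D x y g := by
    rintro x y g (hg | ⟨k, hk, hx, hy, rfl⟩)
    exacts [.inl hg, .inr ⟨k, hx, hy, (if_pos hk).symm⟩]
  have hφD : ∀ x, LabelledWalk D x₀ x (φ x) := fun x => (hφ x).bind fun x y g h =>
    h.elim (fun h => of_arc (hFD _ _ _ h)) fun h =>
      inv_inv g ▸ (of_arc (hFD _ _ _ h)).symm hD
  refine of_loop_generators hD hφD hw ?_
  rintro _ ⟨k, hk, rfl⟩
  exact ⟨s k, t k, .inr ⟨k, rfl, rfl, (if_neg hk).symm⟩⟩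

end Group

end LabelledWalk

section Bipartite

variable {I Λ : Type*} {P : Λ → I → Prop}

/-- The edges of the bipartite graph `P`, directed from `Λ` to `I`. -/
inductive BipartiteArc (P : Λ → I → Prop) : I ⊕ Λ → I ⊕ Λ → Prop
  | intro {l : Λ} {i : I} : P l i → BipartiteArc P (.inr l) (.inl i)

/-- The number of connected components of the bipartite graph `P` on the vertex set `I ⊕ Λ`. -/
noncomputable def componentCount (P : Λ → I → Prop) : ℕ :=
  Nat.card (Quotient (EqvGen.setoid (BipartiteArc P)))

theorem BipartiteArc.mk_eq_mk {l : Λ} {i : I} (h : P l i) :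
    Quotient.mk (EqvGen.setoid (BipartiteArc P)) (.inr l) = Quotient.mk _ (.inl i) :=
  Quotient.sound (.rel _ _ (.intro h))

theorem BipartiteArc.surjective_mk_inl (hP : LeftTotal P) :
    Function.Surjective fun i => Quotient.mk (EqvGen.setoid (BipartiteArc P)) (.inl i) := by
  rintro ⟨i | l⟩
  · exact ⟨i, rfl⟩
  · exact (hP l).imp fun i h => (mk_eq_mk h).symm

theorem BipartiteArc.surjective_mk_inr (hP : RightTotal P) :
    Function.Surjective fun l => Quotient.mk (EqvGen.setoid (BipartiteArc P)) (.inr l) := by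
  rintro ⟨i | l⟩
  · exact (hP i).imp fun l h => mk_eq_mk h
  · exact ⟨l, rfl⟩

theorem componentCount_le_card_left [Finite I] (hP : LeftTotal P) :
    componentCount P ≤ Nat.card I :=
  Nat.card_le_card_of_surjective _ (BipartiteArc.surjective_mk_inl hP)

theorem componentCount_lt_max_card [Finite I] [Finite Λ] (hP : BiTotal P) (hP' : ¬ BiUnique P) :
    componentCount P < max (Nat.card I) (Nat.card Λ) := by
  have hI := BipartiteArc.surjective_mk_inl hP.1
  have hΛ := BipartiteArc.surjective_mk_inr hP.2
  by_cases hinj : Function.Injective fun i =>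
      Quotient.mk (EqvGen.setoid (BipartiteArc P)) (.inl i)
  · refine lt_max_of_lt_right (card_lt_of_surjective_not_injective hΛ fun hinj' => hP' ?_)
    refine ⟨fun l l' i h h' => hinj' ?_, fun l i i' h h' => hinj ?_⟩
    · exact (BipartiteArc.mk_eq_mk h).trans (BipartiteArc.mk_eq_mk h').symm
    · exact (BipartiteArc.mk_eq_mk h).symm.trans (BipartiteArc.mk_eq_mk h')
  · exact lt_max_of_lt_left (card_lt_of_surjective_not_injective hI hinj)

theorem exists_surjective_fin {α : Type*} [Finite α] [Nonempty α] {N : ℕ}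
    (h : Nat.card α ≤ N) : ∃ f : Fin N → α, Function.Surjective f := by
  let e : α ↪ Fin N := (Finite.equivFin α).toEmbedding.trans (Fin.castLEEmb h)
  exact ⟨Function.invFun e, Function.invFun_surjective e.injective⟩

theorem exists_perm_strongly_connected {ι : Type*} [Finite ι] (hP : BiTotal P) {s : ι → I}
    {t : ι → Λ} (hs : Function.Surjective s) (ht : Function.Surjective t) :
    ∃ σ : Equiv.Perm ι, ∀ x y, ReflTransGen
      (fun x y => BipartiteArc P x y ∨ ∃ k, x = .inl (s k) ∧ y = .inr (t (σ k))) x y := by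
  have hst : BiTotal fun k l => P (t k) (s l) :=
    ⟨fun k => hs.exists.1 (hP.1 (t k)), fun l => ht.exists.1 (hP.2 (s l))⟩
  obtain ⟨σ, hσ⟩ := exists_perm_transGen hst
  refine ⟨σ, ?_⟩
  set D : I ⊕ Λ → I ⊕ Λ → Prop :=
    fun x y => BipartiteArc P x y ∨ ∃ k, x = .inl (s k) ∧ y = .inr (t (σ k))
  have hgen : ∀ k, D (.inl (s k)) (.inr (t (σ k))) := fun k => .inr ⟨k, rfl, rfl⟩
  have hP' : ∀ l i, P l i → D (.inr l) (.inl i) := fun l i h => .inl (.intro h)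
  have hss : ∀ k l, ReflTransGen D (.inl (s k)) (.inl (s l)) := fun k l => by
    induction hσ k l with
    | single h => exact (ReflTransGen.single (hgen _)).tail (hP' _ _ h)
    | tail _ h ih => exact (ih.tail (hgen _)).tail (hP' _ _ h)
  have hout : ∀ x, ∃ k, ReflTransGen D x (.inl (s k)) := by
    rintro (i | l)
    · obtain ⟨k, rfl⟩ := hs i
      exact ⟨k, .refl⟩
    · obtain ⟨k, hk⟩ := hs.exists.1 (hP.1 l)
      exact ⟨k, .single (hP' _ _ hk)⟩
  have hin : ∀ y, ∃ k, ReflTransGen D (.inl (s k)) y := by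
    rintro (i | l)
    · obtain ⟨k, rfl⟩ := hs i
      exact ⟨k, .refl⟩
    · obtain ⟨k, rfl⟩ := (ht.comp σ.surjective) l
      exact ⟨k, .single (hgen k)⟩
  intro x y
  obtain ⟨k, hk⟩ := hout x
  obtain ⟨l, hl⟩ := hin y
  exact (hk.trans (hss k l)).trans hl

/-- The bipartite graph `P` without its isolated vertices. -/
def core (P : Λ → I → Prop) (l : {l // ∃ i, P l i}) (i : {i // ∃ l, P l i}) : Prop :=
  P l i

theorem biTotal_core : BiTotal (core P) :=
  ⟨fun ⟨l, i, h⟩ => ⟨⟨i, l, h⟩, h⟩, fun ⟨i, l, h⟩ => ⟨⟨l, i, h⟩, h⟩⟩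

theorem biUnique_core_iff : BiUnique (core P) ↔ BiUnique P where
  mp h :=
    ⟨fun l l' i hl hl' => congrArg Subtype.val
        (@h.1 ⟨l, i, hl⟩ ⟨l', i, hl'⟩ ⟨i, l, hl⟩ hl hl'),
      fun l i i' hi hi' => congrArg Subtype.val
        (@h.2 ⟨l, i, hi⟩ ⟨i, l, hi⟩ ⟨i', l, hi'⟩ hi hi')⟩
  mpr h := ⟨fun _ _ _ hl hl' => Subtype.ext (h.1 hl hl'),
    fun _ _ _ hi hi' => Subtype.ext (h.2 hi hi')⟩

theorem card_eq_card_nonisolated_add_card_isolated [Finite I] (P : Λ → I → Prop) :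
    Nat.card I = Nat.card {i // ∃ l, P l i} + Nat.card {i // ∀ l, ¬ P l i} := by
  classical
  simp only [← not_exists]
  rw [← Nat.card_sum, Nat.card_congr (Equiv.sumCompl fun i => ∃ l, P l i)]

theorem card_nonisolated_le_of_leftUnique [Finite I] (hP : LeftUnique P) :
    Nat.card {l // ∃ i, P l i} ≤ Nat.card {i // ∃ l, P l i} :=
  Nat.card_le_card_of_injective (fun l => ⟨l.2.choose, l, l.2.choose_spec⟩) fun l l' h => by
    have h : l.2.choose = l'.2.choose := congrArg Subtype.val h
    exact Subtype.ext (hP l.2.choose_spec (h ▸ l'.2.choose_spec))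

end Bipartite

/-- The elements `mk (a, g, b)` of the semigroup `M` multiply as in a Rees matrix semigroup over
the group `G` with sandwich matrix `p`, whose nonzero entries are those with `adj b a`. The ideal
`Z` plays the role of the zero. -/
structure IsReesFamily {M A B G : Type*} [Semigroup M] [Group G] (mk : A × G × B → M)
    (p : B → A → G) (adj : B → A → Prop) (Z : Set M) : Prop where
  injective : Function.Injective mk
  mul {a g b a' g' b'} : adj b a' → mk (a, g, b) * mk (a', g', b') = mk (a, g * p b a' * g', b')
  zero {a g b a' g' b'} : ¬ adj b a' → mk (a, g, b) * mk (a', g', b') ∈ Z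
  mul_right {z} : z ∈ Z → ∀ m, z * m ∈ Z
  mul_left {z} : z ∈ Z → ∀ m, m * z ∈ Z
  notMem x : mk x ∉ Z

/-- The labelled digraph on `A ⊕ B` whose walks from `a` to `b` describe the nonzero products of
elements of `X`: generators give arcs from `A` to `B`, nonzero sandwich matrix entries give arcs
from `B` to `A`. -/
inductive ReesArc {M A B G : Type*} (mk : A × G × B → M) (p : B → A → G) (adj : B → A → Prop)
    (X : Set M) : A ⊕ B → A ⊕ B → G → Prop
  | generator {a : A} {g : G} {b : B} : mk (a, g, b) ∈ X → ReesArc mk p adj X (.inl a) (.inr b) g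
  | sandwich {a : A} {b : B} : adj b a → ReesArc mk p adj X (.inr b) (.inl a) (p b a)

theorem exists_subset_image_of_card_le {α β : Type*} [Nonempty β] {s : Finset α} {t : Finset β}
    (h : t.card ≤ s.card) : ∃ f : α → β, (t : Set β) ⊆ f '' s := by
  obtain ⟨u, hus, hu⟩ := Finset.exists_subset_card_eq h
  let e := Finset.equivOfCardEq hu.symm
  refine ⟨Function.extend (fun y => (e y : α)) Subtype.val fun _ => Classical.arbitrary β, ?_⟩
  intro y hy
  have he : Function.Injective fun y => (e y : α) := Subtype.val_injective.comp e.injective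
  exact ⟨e ⟨y, hy⟩, hus (e ⟨y, hy⟩).2, he.extend_apply _ _ ⟨y, hy⟩⟩

section Rees

variable {M A B G : Type*} {mk : A × G × B → M} {p : B → A → G} {adj : B → A → Prop} {Z : Set M}

theorem exists_reesArc_empty_eq_bipartiteArc :
    (fun x y => ∃ g, ReesArc mk p adj ∅ x y g) = BipartiteArc adj := by
  ext x y
  constructor
  · rintro ⟨_, h | h⟩
    exacts [h.elim, .intro h]
  · rintro ⟨h⟩
    exact ⟨_, .sandwich h⟩

theorem ReesArc.mono {X Y : Set M} (hXY : X ⊆ Y) {x y : A ⊕ B} {g : G}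
    (h : ReesArc mk p adj X x y g) : ReesArc mk p adj Y x y g := by
  cases h with
  | generator h => exact .generator (hXY h)
  | sandwich h => exact .sandwich h

namespace IsReesFamily

variable [Semigroup M] [Group G]

theorem comp {I Λ : Type*} (H : IsReesFamily mk p adj Z) {i : I → A} {l : Λ → B}
    (hi : Function.Injective i) (hl : Function.Injective l) :
    IsReesFamily (mk ∘ Prod.map i (Prod.map id l)) (fun b a => p (l b) (i a))
      (fun b a => adj (l b) (i a)) Z where
  injective := H.injective.comp (hi.prodMap (Function.injective_id.prodMap hl))
  mul := H.mul
  zero := H.zero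
  mul_right := H.mul_right
  mul_left := H.mul_left
  notMem _ := H.notMem _

theorem mem_closure_range (H : IsReesFamily mk p adj Z) {m : M}
    (hm : m ∈ Subsemigroup.closure (Set.range mk)) : m ∈ Z ∨ m ∈ Set.range mk := by
  induction hm using Subsemigroup.closure_induction with
  | mem x hx => exact .inr hx
  | mul x y _ _ hx hy =>
    rcases hx with hx | ⟨⟨a, g, b⟩, rfl⟩
    · exact .inl (H.mul_right hx y)
    rcases hy with hy | ⟨⟨a', g', b'⟩, rfl⟩
    · exact .inl (H.mul_left hy _)
    by_cases h : adj b a'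
    · exact .inr ⟨_, (H.mul h).symm⟩
    · exact .inl (H.zero h)

theorem exists_mul_eq (H : IsReesFamily mk p adj Z) {x y : M}
    (hx : x ∈ Subsemigroup.closure (Set.range mk)) (hy : y ∈ Subsemigroup.closure (Set.range mk))
    {a g b} (hxy : x * y = mk (a, g, b)) :
    ∃ g₁ b₁ a₂ g₂, adj b₁ a₂ ∧ x = mk (a, g₁, b₁) ∧ y = mk (a₂, g₂, b) ∧
      g = g₁ * p b₁ a₂ * g₂ := by
  rcases H.mem_closure_range hx with hz | ⟨⟨a₁, g₁, b₁⟩, rfl⟩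
  · exact absurd (hxy ▸ H.mul_right hz y) (H.notMem _)
  rcases H.mem_closure_range hy with hz | ⟨⟨a₂, g₂, b₂⟩, rfl⟩
  · exact absurd (hxy ▸ H.mul_left hz _) (H.notMem _)
  by_cases h : adj b₁ a₂
  · obtain ⟨rfl, rfl, rfl⟩ : a₁ = a ∧ g₁ * p b₁ a₂ * g₂ = g ∧ b₂ = b := by
      simpa only [H.mul h, H.injective.eq_iff, Prod.mk.injEq] using hxy
    exact ⟨g₁, b₁, a₂, g₂, h, rfl, rfl, rfl⟩
  · exact absurd (hxy ▸ H.zero h) (H.notMem _)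

theorem labelledWalk_of_mem (H : IsReesFamily mk p adj Z) {X : Set M}
    (hX : X ⊆ Subsemigroup.closure (Set.range mk)) {a g b}
    (hm : mk (a, g, b) ∈ Subsemigroup.closure X) :
    LabelledWalk (ReesArc mk p adj X) (.inl a) (.inr b) g := by
  generalize hmk : mk (a, g, b) = m at hm
  induction hm using Subsemigroup.closure_induction generalizing a g b with
  | mem x hx => exact .of_arc (.generator (hmk ▸ hx))
  | mul x y hx hy ihx ihy =>
    have hle := Subsemigroup.closure_le.2 hX
    obtain ⟨g₁, b₁, a₂, g₂, h, rfl, rfl, rfl⟩ := H.exists_mul_eq (hle hx) (hle hy) hmk.symm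
    exact ((ihx rfl).trans (.of_arc (.sandwich h))).trans (ihy rfl)

theorem mem_of_labelledWalk (H : IsReesFamily mk p adj Z) {S : Subsemigroup M} {a g b}
    (h : LabelledWalk (ReesArc mk p adj S) (.inl a) (.inr b) g) : mk (a, g, b) ∈ S := by
  -- A walk from `b'` to `b` labelled `g` turns `mk (a, h, b')` into `mk (a, h * g, b)`.
  let Q : A ⊕ B → G → Prop := fun x g => x.elim (fun a => mk (a, g, b) ∈ S)
    fun b' => ∀ a h, mk (a, h, b') ∈ S → mk (a, h * g, b) ∈ S
  suffices key : ∀ x y g, LabelledWalk (ReesArc mk p adj S) x y g → y = .inr b → Q x g from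
    key _ _ _ h rfl
  intro x y g h
  induction h with
  | nil =>
    rintro rfl a h hm
    rwa [mul_one]
  | cons hxy _ ih =>
    intro hy
    cases hxy with
    | generator hm => exact ih hy _ _ hm
    | sandwich hadj =>
      intro a h hm
      have hmem := S.mul_mem hm (ih hy)
      rwa [H.mul hadj, mul_assoc] at hmem

theorem exists_generators [Finite A] [Finite B] [Finite G] [Nonempty A]
    (H : IsReesFamily mk p adj Z) (hadj : BiTotal adj) {U : Finset G}
    (hU : Subgroup.closure (U : Set G) = ⊤) {N : ℕ} (hA : Nat.card A ≤ N) (hB : Nat.card B ≤ N)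
    (hN : componentCount adj + U.card ≤ N + 1) :
    ∃ X : Finset M, X.card ≤ N ∧ (X : Set M) ⊆ Set.range mk ∧
      Set.range mk ⊆ Subsemigroup.closure (X : Set M) := by
  classical
  have : Nonempty B := (hadj.2 (Classical.arbitrary A)).nonempty
  obtain ⟨s, hs⟩ := exists_surjective_fin hA
  obtain ⟨t, ht⟩ := exists_surjective_fin hB
  obtain ⟨σ, hσ⟩ := exists_perm_strongly_connected hadj hs ht
  obtain ⟨T, hTcard, hT⟩ := exists_finset_connecting hσ
  obtain ⟨w, hw⟩ : ∃ w : Fin N → G, (U : Set G) ⊆ w '' (T : Set (Fin N))ᶜ := by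
    rw [← Finset.coe_compl]
    refine exists_subset_image_of_card_le ?_
    rw [Finset.card_compl, Fintype.card_fin]
    have hle : T.card + 1 ≤ componentCount adj := hTcard
    omega
  rw [← exists_reesArc_empty_eq_bipartiteArc (mk := mk) (p := p)] at hT
  obtain ⟨γ, hγ⟩ := LabelledWalk.exists_labels hT
    (fun x y => ReflTransGen.mono
      (fun x y h => h.imp_left (exists_reesArc_empty_eq_bipartiteArc.ge x y)) _ _ (hσ x y))
    (top_unique (hU.ge.trans (Subgroup.closure_mono hw)))
  let x : Fin N → M := fun k => mk (s k, γ k, t (σ k))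
  refine ⟨Finset.univ.image x, Finset.card_image_le.trans (by simp), ?_, ?_⟩
  · simp only [Finset.coe_image, Finset.coe_univ, Set.image_univ]
    exact Set.range_subset_iff.2 fun k => ⟨_, rfl⟩
  · rintro _ ⟨⟨a, g, b⟩, rfl⟩
    refine H.mem_of_labelledWalk ((hγ (.inl a) (.inr b) g).mono ?_)
    rintro _ _ _ (h | ⟨k, rfl, rfl, rfl⟩)
    · exact h.mono (Set.empty_subset _)
    · exact .generator (Subsemigroup.subset_closure (by simp [x]))

end IsReesFamily

end Rees

section Rank

variable {M : Type*} [Semigroup M] {S : Subsemigroup M}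

theorem closure_image_val_eq_iff {X : Set S} :
    Subsemigroup.closure (Subtype.val '' X) = S ↔ Subsemigroup.closure X = ⊤ := by
  have hmap : Subsemigroup.map (MulMemClass.subtype S) ⊤ = S := by
    ext x
    simp
  rw [← (Subsemigroup.map_injective_of_injective (f := MulMemClass.subtype S)
    Subtype.val_injective).eq_iff, MulHom.map_mclosure, hmap]
  rfl

theorem semigroupRank_le_card [Finite S] {X : Finset M}
    (hX : Subsemigroup.closure (X : Set M) = S) : semigroupRank S ≤ X.card := by
  classical
  obtain ⟨X, rfl⟩ : ∃ Y : Finset S, Y.map (.subtype _) = X :=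
    ⟨X.subtype (· ∈ S), Finset.subtype_map_of_mem fun x hx =>
      hX.le (Subsemigroup.subset_closure hx)⟩
  rw [Finset.coe_map] at hX
  rw [Finset.card_map]
  exact (semigroupRank_isLeast S).2 ⟨X, rfl, closure_image_val_eq_iff.1 hX⟩

theorem exists_card_eq_semigroupRank (S : Subsemigroup M) [Finite S] :
    ∃ X : Finset M, X.card = semigroupRank S ∧ Subsemigroup.closure (X : Set M) = S := by
  obtain ⟨X, hcard, hX⟩ := (semigroupRank_isLeast S).1
  refine ⟨X.map (.subtype _), (Finset.card_map _).trans hcard, ?_⟩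
  rw [Finset.coe_map]
  exact closure_image_val_eq_iff.2 hX

end Rank

namespace IsReesFamily

variable {M A B G : Type*} [Group G] {mk : A × G × B → M} {p : B → A → G}
  {adj : B → A → Prop} {Z : Set M}

theorem exists_generator_left {X : Set M} {a g b}
    (hw : LabelledWalk (ReesArc mk p adj X) (.inl a) (.inr b) g) (hb : ∃ a', adj b a') :
    ∃ x : G × B, mk (a, x) ∈ X ∧ ∃ a', adj x.2 a' := by
  cases hw with
  | cons h hw =>
    cases h with
    | generator hm =>
      cases hw with
      | nil => exact ⟨_, hm, hb⟩
      | cons h' _ => cases h' with | sandwich h' => exact ⟨_, hm, _, h'⟩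

theorem exists_generator_right {X : Set M} {a g b}
    (hw : LabelledWalk (ReesArc mk p adj X) (.inl a) (.inr b) g) (ha : ∃ b', adj b' a) :
    ∃ x : A × G, mk (x.1, x.2, b) ∈ X ∧ ∃ b', adj b' x.1 := by
  obtain h | ⟨_, _, _, hw', h⟩ := hw.eq_or_exists_last_arc
  · cases h
  cases h with
  | generator hm =>
    obtain h | ⟨_, _, _, -, h⟩ := hw'.eq_or_exists_last_arc
    · cases h
      exact ⟨(_, _), hm, ha⟩
    · cases h with | sandwich h' => exact ⟨(_, _), hm, _, h'⟩

variable [Semigroup M] {X : Finset M}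

theorem labelledWalk_of_closure_eq (H : IsReesFamily mk p adj Z)
    (hX : Subsemigroup.closure (X : Set M) = Subsemigroup.closure (Set.range mk)) (a g b) :
    LabelledWalk (ReesArc mk p adj X) (.inl a) (.inr b) g :=
  H.labelledWalk_of_mem (Subsemigroup.closure_le.1 hX.le)
    (hX.ge (Subsemigroup.subset_closure ⟨_, rfl⟩))

theorem range_subset_of_forall_not_adj (H : IsReesFamily mk p adj Z) (hadj : ∀ b a, ¬ adj b a)
    (hX : Subsemigroup.closure (X : Set M) = Subsemigroup.closure (Set.range mk)) :
    Set.range mk ⊆ X := by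
  rintro _ ⟨⟨a, g, b⟩, rfl⟩
  cases H.labelledWalk_of_closure_eq hX a g b with
  | cons h hw =>
    cases h with
    | generator h =>
      cases hw with
      | nil => rwa [mul_one]
      | cons h' _ => cases h' with | sandwich h' => exact absurd h' (hadj _ _)

theorem semigroupRank_eq_of_forall_not_adj [Finite M] (H : IsReesFamily mk p adj Z)
    (hadj : ∀ b a, ¬ adj b a) : semigroupRank (Subsemigroup.closure (Set.range mk)) =
      Nat.card A * Nat.card B * Nat.card G := by
  have hmk : Nat.card A * Nat.card B * Nat.card G = (Set.range mk).ncard := by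
    rw [← Nat.card_coe_set_eq, Nat.card_range_of_injective H.injective, Nat.card_prod,
      Nat.card_prod, mul_assoc, mul_comm (Nat.card B)]
  rw [hmk]
  refine le_antisymm ?_ ?_
  · rw [Set.ncard_eq_toFinset_card _ (Set.toFinite _)]
    exact semigroupRank_le_card (by rw [Set.Finite.coe_toFinset])
  · obtain ⟨X, hXcard, hX⟩ := exists_card_eq_semigroupRank (Subsemigroup.closure (Set.range mk))
    rw [← hXcard, ← Set.ncard_coe_finset]
    exact Set.ncard_le_ncard (H.range_subset_of_forall_not_adj hadj hX)

theorem mem_of_core (H : IsReesFamily mk p adj Z) {S : Subsemigroup M} {b₀ a₀} (h₀ : adj b₀ a₀)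
    (hcore : ∀ a g b, (∃ b', adj b' a) → (∃ a', adj b a') → mk (a, g, b) ∈ S)
    (hA : ∀ a, (∀ b, ¬ adj b a) → mk (a, 1, b₀) ∈ S)
    (hB : ∀ b, (∀ a, ¬ adj b a) → mk (a₀, 1, b) ∈ S) (a g b) : mk (a, g, b) ∈ S := by
  have hleft (a g b) (hb : ∃ a', adj b a') : mk (a, g, b) ∈ S := by
    by_cases ha : ∃ b', adj b' a
    · exact hcore a g b ha hb
    · have hmem := S.mul_mem (hA a (not_exists.1 ha))
        (hcore a₀ ((p b₀ a₀)⁻¹ * g) b ⟨b₀, h₀⟩ hb)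
      rwa [H.mul h₀, one_mul, mul_inv_cancel_left] at hmem
  by_cases hb : ∃ a', adj b a'
  · exact hleft a g b hb
  · have hmem := S.mul_mem (hleft a (g * (p b₀ a₀)⁻¹) b₀ ⟨a₀, h₀⟩) (hB b (not_exists.1 hb))
    rwa [H.mul h₀, inv_mul_cancel_right, mul_one] at hmem

theorem exists_generators_left (H : IsReesFamily mk p adj Z)
    (hX : Subsemigroup.closure (X : Set M) = Subsemigroup.closure (Set.range mk))
    {b₀ a₀} (h₀ : adj b₀ a₀) :
    ∃ (x : A → G × B) (f : A ⊕ {b // ∀ a, ¬ adj b a} → X), Function.Injective f ∧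
      (∀ a, (f (.inl a) : M) = mk (a, x a)) ∧
      ∀ b, ∃ y : A × G, (f (.inr b) : M) = mk (y.1, y.2, b) := by
  have hw := H.labelledWalk_of_closure_eq hX
  choose x hxX hx using fun a => exists_generator_left (hw a 1 b₀) ⟨a₀, h₀⟩
  choose y hyX _ using fun b => exists_generator_right (hw a₀ 1 b) ⟨b₀, h₀⟩
  refine ⟨x, Sum.elim (fun a => ⟨_, hxX a⟩) (fun b => ⟨_, hyX b⟩),
    .sumElim (fun a a' h => ?_) (fun b b' h => ?_) (fun a b h => ?_), fun a => rfl,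
    fun b => ⟨y b, rfl⟩⟩
  all_goals have h := H.injective (congrArg Subtype.val h)
  · exact congrArg Prod.fst h
  · exact Subtype.ext (congrArg (fun q => q.2.2) h)
  · obtain ⟨a', ha'⟩ := hx a
    exact b.2 a' ((congrArg (fun q => q.2.2) h : (x a).2 = b) ▸ ha')

variable [Finite A] [Finite B]

theorem card_left_le (H : IsReesFamily mk p adj Z)
    (hX : Subsemigroup.closure (X : Set M) = Subsemigroup.closure (Set.range mk))
    {b₀ a₀} (h₀ : adj b₀ a₀) : Nat.card A + Nat.card {b // ∀ a, ¬ adj b a} ≤ X.card := by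
  obtain ⟨-, f, hf, -⟩ := H.exists_generators_left hX h₀
  simpa [Nat.card_sum] using Nat.card_le_card_of_injective f hf

theorem card_right_le (H : IsReesFamily mk p adj Z)
    (hX : Subsemigroup.closure (X : Set M) = Subsemigroup.closure (Set.range mk))
    {b₀ a₀} (h₀ : adj b₀ a₀) : Nat.card B + Nat.card {a // ∀ b, ¬ adj b a} ≤ X.card := by
  have hw := H.labelledWalk_of_closure_eq hX
  choose x hxX _ using fun a => exists_generator_left (hw a 1 b₀) ⟨a₀, h₀⟩
  choose y hyX hy using fun b => exists_generator_right (hw a₀ 1 b) ⟨b₀, h₀⟩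
  let f : B ⊕ {a // ∀ b, ¬ adj b a} → X :=
    Sum.elim (fun b => ⟨_, hyX b⟩) (fun a => ⟨_, hxX a⟩)
  suffices hf : Function.Injective f by
    simpa [Nat.card_sum] using Nat.card_le_card_of_injective f hf
  refine .sumElim (fun b b' h => ?_) (fun a a' h => ?_) (fun b a h => ?_)
  all_goals have h := H.injective (congrArg Subtype.val h)
  · exact congrArg (fun q => q.2.2) h
  · exact Subtype.ext (congrArg Prod.fst h)
  · obtain ⟨b', hb'⟩ := hy b
    exact a.2 b' ((Prod.mk.inj h).1 ▸ hb')

/-- With as few generators as `card_left_le` permits, each vertex on a closed walk is left by a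
single arc. -/
theorem commute_of_card_le (H : IsReesFamily mk p adj Z)
    (hX : Subsemigroup.closure (X : Set M) = Subsemigroup.closure (Set.range mk))
    {b₀ a₀} (h₀ : adj b₀ a₀) (hadj : RightUnique adj)
    (hcard : X.card ≤ Nat.card A + Nat.card {b // ∀ a, ¬ adj b a}) (g h : G) : Commute g h := by
  obtain ⟨x, f, hf, hfl, hfr⟩ := H.exists_generators_left hX h₀
  have hbij : Function.Bijective f := (Nat.bijective_iff_injective_and_card f).2
    ⟨hf, by simpa [Nat.card_sum] using (H.card_left_le hX h₀).antisymm hcard⟩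
  have hgen {a g b} (hm : mk (a, g, b) ∈ X) (hb : ∃ a', adj b a') : x a = (g, b) := by
    obtain ⟨a' | b', hm'⟩ := hbij.2 ⟨_, hm⟩
    · obtain ⟨rfl, hx⟩ : a' = a ∧ x a' = (g, b) := Prod.mk.injEq .. ▸
        H.injective ((hfl a').symm.trans (congrArg Subtype.val hm'))
      exact hx
    · obtain ⟨y, hy⟩ := hfr b'
      have hb' : (b' : B) = b := congrArg (fun q => q.2.2) <|
        H.injective (hy.symm.trans (congrArg Subtype.val hm'))
      exact absurd (hb' ▸ hb) (not_exists.2 b'.2)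
  let q : B → A := fun b => @Classical.epsilon A ⟨a₀⟩ (adj b)
  have hq {b a} (hba : adj b a) : q b = a := hadj (Classical.epsilon_spec ⟨a, hba⟩) hba
  have hloop (g : G) : LabelledWalk (ReesArc mk p adj X) (.inl a₀) (.inl a₀) g := by
    simpa only [inv_mul_cancel_right] using
      (H.labelledWalk_of_closure_eq hX a₀ (g * (p b₀ a₀)⁻¹) b₀).trans (.of_arc (.sandwich h₀))
  refine LabelledWalk.commute_of_deterministic
    (f := Sum.elim (fun a => .inr (x a).2) fun b => .inl (q b))
    (c := Sum.elim (fun a => (x a).1) fun b => p b (q b)) ?_ (hloop g) (hloop h) ?_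
  · rintro _ _ _ (hm | hba) ⟨_, _, hnext⟩
    · cases hnext with | sandwich hba => simp only [Sum.elim_inl, hgen hm ⟨_, hba⟩, and_self]
    · simp only [Sum.elim_inr, hq hba, and_self]
  · obtain ⟨y, hy, -⟩ := exists_generator_left (H.labelledWalk_of_closure_eq hX a₀ 1 b₀) ⟨a₀, h₀⟩
    exact ⟨_, _, .generator hy⟩

variable [Finite G] [Finite M]

theorem semigroupRank_le (H : IsReesFamily mk p adj Z) {b₀ a₀} (h₀ : adj b₀ a₀) {U : Finset G}
    (hU : Subgroup.closure (U : Set G) = ⊤) {N : ℕ} (hA : Nat.card {a // ∃ b, adj b a} ≤ N)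
    (hB : Nat.card {b // ∃ a, adj b a} ≤ N) (hN : componentCount (core adj) + U.card ≤ N + 1) :
    semigroupRank (Subsemigroup.closure (Set.range mk)) ≤
      N + (Nat.card {a // ∀ b, ¬ adj b a} + Nat.card {b // ∀ a, ¬ adj b a}) := by
  classical
  have := Fintype.ofFinite {a // ∀ b, ¬ adj b a}
  have := Fintype.ofFinite {b // ∀ a, ¬ adj b a}
  have : Nonempty {a // ∃ b, adj b a} := ⟨⟨a₀, b₀, h₀⟩⟩
  obtain ⟨X, hXN, hXmk, hX⟩ :=
    (H.comp Subtype.val_injective Subtype.val_injective).exists_generators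
      (biTotal_core (P := adj)) hU hA hB hN
  let XA : Finset M := Finset.univ.image fun a : {a // ∀ b, ¬ adj b a} => mk (a, 1, b₀)
  let XB : Finset M := Finset.univ.image fun b : {b // ∀ a, ¬ adj b a} => mk (a₀, 1, b)
  have hcard : (X ∪ (XA ∪ XB)).card ≤
      N + (Nat.card {a // ∀ b, ¬ adj b a} + Nat.card {b // ∀ a, ¬ adj b a}) := by
    simp only [Nat.card_eq_fintype_card]
    exact (Finset.card_union_le _ _).trans <| add_le_add hXN <|
      (Finset.card_union_le _ _).trans (add_le_add Finset.card_image_le Finset.card_image_le)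
  refine (semigroupRank_le_card (le_antisymm ?_ ?_)).trans hcard
  · refine Subsemigroup.closure_mono ?_
    simp only [Finset.coe_union, Set.union_subset_iff]
    refine ⟨hXmk.trans (Set.range_comp_subset_range _ _), ?_, ?_⟩ <;>
    · simp only [XA, XB, Finset.coe_image, Finset.coe_univ, Set.image_univ]
      exact Set.range_subset_iff.2 fun _ => ⟨_, rfl⟩
  · rw [Subsemigroup.closure_le]
    rintro _ ⟨⟨a, g, b⟩, rfl⟩
    refine H.mem_of_core h₀ (fun a g b ha hb => ?_) (fun a ha => ?_) (fun b hb => ?_) a g b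
    · exact Subsemigroup.closure_mono (by simp) (hX ⟨(⟨a, ha⟩, g, ⟨b, hb⟩), rfl⟩)
    · have hmem : mk (a, 1, b₀) ∈ XA := Finset.mem_image.2 ⟨⟨a, ha⟩, Finset.mem_univ _, rfl⟩
      exact Subsemigroup.subset_closure (by simp [hmem])
    · have hmem : mk (a₀, 1, b) ∈ XB := Finset.mem_image.2 ⟨⟨b, hb⟩, Finset.mem_univ _, rfl⟩
      exact Subsemigroup.subset_closure (by simp [hmem])

theorem semigroupRank_eq (H : IsReesFamily mk p adj Z) {b₀ a₀} (h₀ : adj b₀ a₀) {U : Finset G}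
    (hU : Subgroup.closure (U : Set G) = ⊤)
    (hcount : componentCount (core adj) + U.card ≤
      max (Nat.card {a // ∃ b, adj b a}) (Nat.card {b // ∃ a, adj b a}) + 1) :
    semigroupRank (Subsemigroup.closure (Set.range mk)) =
      max (Nat.card {a // ∃ b, adj b a}) (Nat.card {b // ∃ a, adj b a}) +
        (Nat.card {a // ∀ b, ¬ adj b a} + Nat.card {b // ∀ a, ¬ adj b a}) := by
  refine (H.semigroupRank_le h₀ hU (le_max_left _ _) (le_max_right _ _) hcount).antisymm ?_
  obtain ⟨X, hXcard, hX⟩ := exists_card_eq_semigroupRank (Subsemigroup.closure (Set.range mk))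
  have hleft := H.card_left_le hX h₀
  have hright := H.card_right_le hX h₀
  rw [card_eq_card_nonisolated_add_card_isolated adj] at hleft
  rw [card_eq_card_nonisolated_add_card_isolated fun a b => adj b a] at hright
  omega

theorem semigroupRank_eq_add_one (H : IsReesFamily mk p adj Z) {b₀ a₀} (h₀ : adj b₀ a₀)
    (hadj : BiUnique adj) {U : Finset G} (hU : Subgroup.closure (U : Set G) = ⊤)
    (hUcard : U.card ≤ 2) {g h : G} (hgh : ¬ Commute g h) :
    semigroupRank (Subsemigroup.closure (Set.range mk)) =
      max (Nat.card {a // ∃ b, adj b a}) (Nat.card {b // ∃ a, adj b a}) +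
        (Nat.card {a // ∀ b, ¬ adj b a} + Nat.card {b // ∀ a, ¬ adj b a}) + 1 := by
  have hBA := card_nonisolated_le_of_leftUnique hadj.1
  have hcount := componentCount_le_card_left (biTotal_core (P := adj)).1
  rw [max_eq_left hBA]
  refine le_antisymm ?_ ?_
  · have hle := H.semigroupRank_le h₀ hU (Nat.le_succ _) (hBA.trans (Nat.le_succ _))
      (by omega)
    omega
  · obtain ⟨X, hXcard, hX⟩ := exists_card_eq_semigroupRank (Subsemigroup.closure (Set.range mk))
    have hlt := lt_of_not_ge fun hcard => hgh (H.commute_of_card_le hX h₀ hadj.2 hcard g h)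
    rw [card_eq_card_nonisolated_add_card_isolated adj] at hlt
    omega

end IsReesFamily

section Transformations

variable {Ω κ I Λ : Type*} {e : I → κ → Ω} {f : Λ → Ω → κ}

/-- The transformation whose image is parametrised by `e i`, whose kernel classes are numbered by
`f l`, and which matches the two by the permutation `g`. -/
def coordMap (e : I → κ → Ω) (f : Λ → Ω → κ) (q : I × Equiv.Perm κ × Λ) : Function.End Ω :=
  e q.1 ∘ q.2.1 ∘ f q.2.2

open Classical in
/-- The permutation by which the image numbered `i` meets the kernel classes numbered `l`, with
junk value `1` if the image is not a transversal of the kernel. -/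
noncomputable def coordSandwich (e : I → κ → Ω) (f : Λ → Ω → κ) (l : Λ) (i : I) :
    Equiv.Perm κ :=
  if h : Function.Bijective (f l ∘ e i) then Equiv.ofBijective _ h else 1

theorem range_coordMap (hf : ∀ l, Function.Surjective (f l)) (q : I × Equiv.Perm κ × Λ) :
    Set.range (coordMap e f q) = Set.range (e q.1) :=
  (q.2.1.surjective.comp (hf q.2.2)).range_comp (e q.1)

theorem ker_coordMap (he : ∀ i, Function.Injective (e i)) (q : I × Equiv.Perm κ × Λ) :
    Setoid.ker (coordMap e f q) = Setoid.ker (f q.2.2) :=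
  Setoid.ext fun _ _ => ((he q.1).comp q.2.1.injective).eq_iff

theorem exists_perm_comp_eq {e : κ → Ω} {f α : Ω → _} (he : Function.Injective e)
    (hf : Function.Surjective f) (hrange : Set.range α = Set.range e)
    (hker : Setoid.ker α = Setoid.ker f) : ∃ g : Equiv.Perm κ, e ∘ g ∘ f = α := by
  have hαf (x y) : α x = α y ↔ f x = f y := Setoid.ext_iff.1 hker x y
  obtain ⟨h, rfl⟩ : ∃ h, h ∘ f = α :=
    ⟨α ∘ Function.surjInv hf, funext fun x => (hαf _ _).2 (Function.surjInv_eq hf _)⟩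
  have hh : Function.Injective h := hf.forall₂.2 fun x y => (hαf x y).1
  rw [hf.range_comp] at hrange
  refine ⟨(Equiv.ofInjective h hh).trans <|
    (Equiv.setCongr hrange).trans (Equiv.ofInjective e he).symm, funext fun x => ?_⟩
  exact Equiv.apply_ofInjective_symm he _

theorem range_coordMap_eq (he : ∀ i, Function.Injective (e i))
    (hf : ∀ l, Function.Surjective (f l)) : Set.range (coordMap e f) =
      {α | (∃ i, Set.range α = Set.range (e i)) ∧ ∃ l, Setoid.ker α = Setoid.ker (f l)} := by
  ext α
  constructor
  · rintro ⟨q, rfl⟩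
    exact ⟨⟨_, range_coordMap hf q⟩, _, ker_coordMap he q⟩
  · rintro ⟨⟨i, hi⟩, l, hl⟩
    obtain ⟨g, hg⟩ := exists_perm_comp_eq (he i) (hf l) hi hl
    exact ⟨(i, g, l), hg⟩

theorem injective_coordMap (he : ∀ i, Function.Injective (e i))
    (hf : ∀ l, Function.Surjective (f l)) (hI : Function.Injective fun i => Set.range (e i))
    (hΛ : Function.Injective fun l => Setoid.ker (f l)) : Function.Injective (coordMap e f) := by
  rintro ⟨i, g, l⟩ ⟨i', g', l'⟩ h
  obtain rfl : i = i' := hI <| by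
    simpa only [range_coordMap hf] using congrArg (fun α : Ω → Ω => Set.range α) h
  obtain rfl : l = l' := hΛ <| by
    simpa only [ker_coordMap he] using congrArg (fun α : Ω → Ω => Setoid.ker α) h
  have hg : (g : κ → κ) = g' := (hf l).injective_comp_right ((he i).comp_left h)
  rw [DFunLike.coe_injective hg]

theorem isReesFamily_coordMap [Finite κ] (he : ∀ i, Function.Injective (e i))
    (hf : ∀ l, Function.Surjective (f l)) (hI : Function.Injective fun i => Set.range (e i))
    (hΛ : Function.Injective fun l => Setoid.ker (f l)) :
    IsReesFamily (coordMap e f) (coordSandwich e f) (fun l i => Function.Bijective (f l ∘ e i))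
      {α | (Set.range α).encard < ENat.card κ} where
  injective := injective_coordMap he hf hI hΛ
  mul h := by
    simp only [coordSandwich, dif_pos h]
    rfl
  zero {i g l i' g' l'} h := by
    have hrange : Set.range (coordMap e f (i, g, l) * coordMap e f (i', g', l')) ⊆
        (e i ∘ g) '' Set.range (f l ∘ e i') := by
      rintro _ ⟨x, rfl⟩
      exact ⟨_, ⟨g' (f l' x), rfl⟩, rfl⟩
    have hproper : Set.range (f l ∘ e i') ⊂ Set.univ := Set.ssubset_univ_iff.2 fun hsurj =>
      h (Set.range_eq_univ.1 hsurj).bijective_of_finite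
    calc _ ≤ (Set.range (f l ∘ e i')).encard :=
          (Set.encard_le_encard hrange).trans (Set.encard_image_le _ _)
      _ < Set.univ.encard := (Set.toFinite _).encard_lt_encard hproper
      _ = ENat.card κ := Set.encard_univ κ
  mul_right hz m := (Set.encard_le_encard (Set.range_comp_subset_range m _)).trans_lt hz
  mul_left {z} hz m := by
    have hrange : Set.range (m * z) = m '' Set.range z := Set.range_comp m z
    exact (congrArg Set.encard hrange).trans_le (Set.encard_image_le _ _) |>.trans_lt hz
  notMem q := by
    rw [Set.mem_ofPred_eq, range_coordMap hf, ← Set.image_univ, (he _).encard_image,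
      Set.encard_univ]
    exact lt_irrefl _

end Transformations

theorem exists_surjective_ker_eq {Ω : Type*} [Finite Ω] (b : Setoid Ω) :
    ∃ f : Ω → Fin b.classes.ncard, Function.Surjective f ∧ Setoid.ker f = b := by
  have hcard : Nat.card (Quotient b) = b.classes.ncard :=
    Nat.card_congr (Setoid.quotientEquivClasses b)
  let q := Finite.equivFinOfCardEq hcard
  refine ⟨q ∘ Quotient.mk b, q.surjective.comp Quotient.mk_surjective, ?_⟩
  exact Setoid.ext fun x y => q.injective.eq_iff.trans Quotient.eq

theorem isTransversal_iff_bijective {n : ℕ} {κ : Type*} {a : Finset (Fin n)} {e : κ → Fin n}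
    {f : Fin n → κ} (he : Function.Injective e) (hea : Set.range e = a)
    (hf : Function.Surjective f) :
    IsTransversal a (Setoid.ker f) ↔ Function.Bijective (f ∘ e) := by
  have ha (x) : x ∈ a ↔ ∃ k, e k = x := (Set.ext_iff.1 hea x).symm
  have hclasses : IsTransversal a (Setoid.ker f) ↔ ∀ y, ∃! x, x ∈ a ∧ f x = y := by
    refine ⟨fun h => hf.forall.2 fun x => h _ ⟨x, rfl⟩, ?_⟩
    rintro h _ ⟨x, rfl⟩
    exact h (f x)
  rw [hclasses, Function.bijective_iff_existsUnique]
  refine forall_congr' fun y => ?_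
  constructor
  · rintro ⟨x, ⟨hxa, hx⟩, huniq⟩
    obtain ⟨k, rfl⟩ := (ha x).1 hxa
    exact ⟨k, hx, fun k' hk' => he (huniq _ ⟨(ha _).2 ⟨k', rfl⟩, hk'⟩)⟩
  · rintro ⟨k, hk, huniq⟩
    refine ⟨e k, ⟨(ha _).2 ⟨k, rfl⟩, hk⟩, ?_⟩
    rintro x ⟨hxa, hx⟩
    obtain ⟨k', rfl⟩ := (ha x).1 hxa
    rw [huniq k' hx]

theorem exists_isReesFamily {n r : ℕ} {A : Finset (Finset (Fin n))} (hA : ∀ a ∈ A, a.card = r)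
    {B : Finset (Setoid (Fin n))} (hB : ∀ b ∈ B, b.classes.ncard = r) :
    ∃ (mk : A × Equiv.Perm (Fin r) × B → Function.End (Fin n)) (p : B → A → Equiv.Perm (Fin r))
      (Z : Set (Function.End (Fin n))),
      IsReesFamily mk p (fun b a => IsTransversal a.1 b.1) Z ∧
        prescribedSemigroup A B = Subsemigroup.closure (Set.range mk) := by
  let e (a : A) : Fin r → Fin n := a.1.orderEmbOfFin (hA a.1 a.2)
  have he (a) : Function.Injective (e a) := (a.1.orderEmbOfFin _).injective
  have hea (a) : Set.range (e a) = a.1 := a.1.range_orderEmbOfFin _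
  choose f hf hfb using fun b : B => hB b.1 b.2 ▸ exists_surjective_ker_eq b.1
  refine ⟨coordMap e f, coordSandwich e f, {α | (Set.range α).encard < ENat.card (Fin r)}, ?_, ?_⟩
  · have hadj : (fun (b : B) (a : A) => IsTransversal a.1 b.1) =
        fun b a => Function.Bijective (f b ∘ e a) := by
      ext b a
      rw [← hfb b, isTransversal_iff_bijective (he a) (hea a) (hf b)]
    rw [hadj]
    refine isReesFamily_coordMap he hf ?_ ?_
    · simp only [hea]
      exact Finset.coe_injective.comp Subtype.val_injective
    · simpa only [hfb] using Subtype.val_injective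
  · rw [range_coordMap_eq he hf, prescribedSemigroup]
    congr 1
    ext α
    refine and_congr ?_ ?_ <;> simp [hea, hfb]

theorem exists_finset_closure_perm_fin_card_le_two (r : ℕ) :
    ∃ U : Finset (Equiv.Perm (Fin r)), Subgroup.closure (U : Set (Equiv.Perm (Fin r))) = ⊤ ∧
      U.card ≤ 2 := by
  match r with
  | 0 | 1 => exact ⟨∅, Subsingleton.elim _ _, by simp⟩
  | k + 2 =>
    refine ⟨{finRotate (k + 2), Equiv.swap 0 (finRotate (k + 2) 0)}, ?_, Finset.card_le_two⟩
    rw [Finset.coe_pair]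
    exact Equiv.Perm.closure_cycle_adjacent_swap isCycle_finRotate support_finRotate 0

theorem exists_finset_closure_perm_fin_card_le_one {r : ℕ} (hr : r ≤ 2) :
    ∃ U : Finset (Equiv.Perm (Fin r)), Subgroup.closure (U : Set (Equiv.Perm (Fin r))) = ⊤ ∧
      U.card ≤ 1 := by
  have : IsCyclic (Equiv.Perm (Fin r)) := by
    match r with
    | 0 | 1 => infer_instance
    | 2 => exact isCyclic_of_prime_card (p := 2) (by simp [Fintype.card_perm])
  obtain ⟨g, hg⟩ := isCyclic_iff_exists_zpowers_eq_top.1 this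
  exact ⟨{g}, by rw [Finset.coe_singleton, ← Subgroup.zpowers_eq_closure, hg],
    (Finset.card_singleton g).le⟩

theorem exists_not_commute_perm_fin {r : ℕ} (hr : 2 < r) :
    ∃ g h : Equiv.Perm (Fin r), ¬ Commute g h := by
  obtain ⟨i, j, k, hij, hik, hjk⟩ :=
    Fintype.two_lt_card_iff.1 (hr.trans_eq (Fintype.card_fin r).symm)
  refine ⟨Equiv.swap i j, Equiv.swap j k, fun h => hjk ?_⟩
  simpa [Equiv.swap_apply_of_ne_of_ne hij hik, Equiv.swap_apply_of_ne_of_ne hik.symm hjk.symm]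
    using Equiv.congr_fun h.eq i

section Graph

theorem maxDeg_le_one_iff {V : Type*} [Fintype V] {Γ : SimpleGraph V} :
    maxDeg Γ ≤ 1 ↔ RightUnique Γ.Adj := by
  classical
  have hdeg (v) : Γ.degree v ≤ 1 ↔ ∀ x y, Γ.Adj v x → Γ.Adj v y → x = y := by
    simp only [← SimpleGraph.card_neighborFinset_eq_degree, Finset.card_le_one,
      SimpleGraph.mem_neighborFinset]
    tauto
  constructor
  · exact fun h v x y => (hdeg v).1 ((Γ.degree_le_maxDegree v).trans h) x y
  · exact fun h => Γ.maxDegree_le_of_forall_degree_le 1 fun v => (hdeg v).2 fun x y => @h v x y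

theorem maxDeg_eq_zero_iff {V : Type*} [Fintype V] {Γ : SimpleGraph V} :
    maxDeg Γ = 0 ↔ ∀ x y, ¬ Γ.Adj x y := by
  classical
  have hdeg (v) : Γ.degree v = 0 ↔ ∀ x, ¬ Γ.Adj v x := by
    rw [← not_exists, ← SimpleGraph.degree_pos_iff_exists_adj, Nat.pos_iff_ne_zero, not_not]
  simp only [← hdeg]
  exact ⟨fun h v => Nat.eq_zero_of_le_zero ((Γ.degree_le_maxDegree v).trans_eq h),
    fun h => Nat.eq_zero_of_le_zero (Γ.maxDegree_le_of_forall_degree_le 0 fun v => (h v).le)⟩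

variable {n : ℕ} {A : Finset (Finset (Fin n))} {B : Finset (Setoid (Fin n))}

theorem maxDeg_transversalGraph_le_one_iff : maxDeg (transversalGraph A B) ≤ 1 ↔
    BiUnique fun (b : B) (a : A) => IsTransversal a.1 b.1 := by
  rw [maxDeg_le_one_iff]
  constructor
  · exact fun h => ⟨fun b b' a hb hb' => Sum.inr_injective (@h (.inl a) (.inr b) (.inr b') hb hb'),
      fun b a a' ha ha' => Sum.inl_injective (@h (.inr b) (.inl a) (.inl a') ha ha')⟩
  · rintro h (a | b) (x | x) (y | y) hx hy <;> simp only [transversalGraph] at hx hy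
    exacts [congrArg Sum.inr (h.1 hx hy), congrArg Sum.inl (h.2 hx hy)]

theorem maxDeg_transversalGraph_eq_zero_iff : maxDeg (transversalGraph A B) = 0 ↔
    ∀ (b : B) (a : A), ¬ IsTransversal a.1 b.1 := by
  rw [maxDeg_eq_zero_iff]
  refine ⟨fun h b a => h (.inr b) (.inl a), ?_⟩
  rintro h (a | b) (a' | b') hab
  exacts [hab, h b' a hab, h b a' hab, hab]

theorem vPos_imageVertices : vPos (transversalGraph A B) (imageVertices A B) =
    Nat.card {a : A // ∃ b : B, IsTransversal a.1 b.1} := by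
  classical
  rw [vPos, imageVertices, Finset.filter_map, Finset.card_map, ← Fintype.card_subtype,
    ← Nat.card_eq_fintype_card]
  simp only [SimpleGraph.degree_pos_iff_exists_adj]
  simp [transversalGraph]

theorem vPos_kernelVertices : vPos (transversalGraph A B) (kernelVertices A B) =
    Nat.card {b : B // ∃ a : A, IsTransversal a.1 b.1} := by
  classical
  rw [vPos, kernelVertices, Finset.filter_map, Finset.card_map, ← Fintype.card_subtype,
    ← Nat.card_eq_fintype_card]
  simp only [SimpleGraph.degree_pos_iff_exists_adj]
  simp [transversalGraph]

theorem vZero_univ : vZero (transversalGraph A B) Finset.univ =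
    Nat.card {a : A // ∀ b : B, ¬ IsTransversal a.1 b.1} +
      Nat.card {b : B // ∀ a : A, ¬ IsTransversal a.1 b.1} := by
  classical
  rw [vZero, ← Nat.card_sum, ← Fintype.card_subtype, ← Nat.card_eq_fintype_card]
  refine Nat.card_congr (Equiv.subtypeSum.trans (Equiv.sumCongr ?_ ?_)) <;>
  · refine Equiv.subtypeEquivRight fun x => ?_
    rw [← not_iff_not, ← Ne, ← Nat.pos_iff_ne_zero, SimpleGraph.degree_pos_iff_exists_adj]
    simp [transversalGraph]

end Graph

theorem theorem3p5_general (n r : ℕ) (A : Finset (Finset (Fin n))) (hA : ∀ a ∈ A, a.card = r)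
    (B : Finset (Setoid (Fin n))) (hB : ∀ b ∈ B, b.classes.ncard = r) :
    (2 ≤ maxDeg (transversalGraph A B) →
      semigroupRank (prescribedSemigroup A B) =
        max (vPos (transversalGraph A B) (imageVertices A B))
            (vPos (transversalGraph A B) (kernelVertices A B))
          + vZero (transversalGraph A B) Finset.univ) ∧
    (maxDeg (transversalGraph A B) = 1 →
      semigroupRank (prescribedSemigroup A B) =
        max (vPos (transversalGraph A B) (imageVertices A B))
            (vPos (transversalGraph A B) (kernelVertices A B))
          + vZero (transversalGraph A B) Finset.univ + if 2 < r then 1 else 0) ∧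
    (maxDeg (transversalGraph A B) = 0 →
      semigroupRank (prescribedSemigroup A B) = A.card * B.card * r.factorial) := by
  obtain ⟨mk, p, Z, H, hS⟩ := exists_isReesFamily hA hB
  have : Finite (Function.End (Fin n)) := inferInstanceAs (Finite (Fin n → Fin n))
  have hrank : semigroupRank (prescribedSemigroup A B) =
      semigroupRank (Subsemigroup.closure (Set.range mk)) := by congr!
  simp only [hrank, vPos_imageVertices, vPos_kernelVertices, vZero_univ]
  have hedge (h : maxDeg (transversalGraph A B) ≠ 0) :
      ∃ (b : B) (a : A), IsTransversal a.1 b.1 := by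
    simpa only [ne_eq, maxDeg_transversalGraph_eq_zero_iff, not_forall, not_not] using h
  refine ⟨fun h => ?_, fun h => ?_, fun h => ?_⟩
  · obtain ⟨b₀, a₀, h₀⟩ := hedge (by omega)
    obtain ⟨U, hU, hUcard⟩ := exists_finset_closure_perm_fin_card_le_two r
    have hadj := mt maxDeg_transversalGraph_le_one_iff.2 (Nat.not_le_of_lt h)
    have hcount := componentCount_lt_max_card biTotal_core (mt biUnique_core_iff.1 hadj)
    exact H.semigroupRank_eq h₀ hU (by omega)
  · obtain ⟨b₀, a₀, h₀⟩ := hedge (by omega)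
    split_ifs with hr
    · obtain ⟨U, hU, hUcard⟩ := exists_finset_closure_perm_fin_card_le_two r
      obtain ⟨g, g', hg⟩ := exists_not_commute_perm_fin hr
      exact H.semigroupRank_eq_add_one h₀ (maxDeg_transversalGraph_le_one_iff.1 h.le) hU hUcard hg
    · obtain ⟨U, hU, hUcard⟩ := exists_finset_closure_perm_fin_card_le_one (not_lt.1 hr)
      have hcount := componentCount_le_card_left
        (biTotal_core (P := fun (b : B) (a : A) => IsTransversal a.1 b.1)).1
      exact H.semigroupRank_eq h₀ hU (by omega)
  · rw [H.semigroupRank_eq_of_forall_not_adj (maxDeg_transversalGraph_eq_zero_iff.1 h)]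
    simp [Fintype.card_perm]

theorem theorem3p5 (n r : ℕ) (hr : 2 < r) (hrn : r < n)
    (A : Finset (Finset (Fin n))) (hA : ∀ a ∈ A, a.card = r)
    (B : Finset (Setoid (Fin n))) (hB : ∀ b ∈ B, b.classes.ncard = r) :
    (2 ≤ maxDeg (transversalGraph A B) →
      semigroupRank (prescribedSemigroup A B) =
        max (vPos (transversalGraph A B) (imageVertices A B))
            (vPos (transversalGraph A B) (kernelVertices A B))
          + vZero (transversalGraph A B) Finset.univ) ∧
    (maxDeg (transversalGraph A B) = 1 →
      semigroupRank (prescribedSemigroup A B) =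
        max (vPos (transversalGraph A B) (imageVertices A B))
            (vPos (transversalGraph A B) (kernelVertices A B))
          + vZero (transversalGraph A B) Finset.univ + 1) ∧
    (maxDeg (transversalGraph A B) = 0 →
      semigroupRank (prescribedSemigroup A B) = A.card * B.card * r.factorial) := by
  simpa only [if_pos hr] using theorem3p5_general n r A hA B hB
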